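/- Let $\Omega$ be a nonempty set, $\mathbb K$ a nonempty set of maps $z:[0,\infty)\to\Omega$, and $g:\Omega\to[0,1]$ a function such that $t\mapsto g(z(t))$ is Borel measurable for every $z\in\mathbb K$. For every $\omega\in\Omega$ let nonempty sets $\mathcal L(\omega)$ and $\mathcal M(\omega)$ be given, and let each pair $(l,m)\in\mathcal L(\omega)\times\mathcal M(\omega)$ determine a process $z[\omega,l,m]\in\mathbb K$ with $z[\omega,l,m](0)=\omega$. For $T,\lambda>0$ and $z\in\mathbb K$ put $$v_T(z)=\frac1T\int_0^T g(z(t))\,dt,\qquad w_\lambda(z)=\lambda\int_0^\infty e^{-\lambda t}g(z(t))\,dt,$$ and for a bounded payoff $c:\mathbb K\to\mathbb R$ put $$\mathbb V[c](\omega)=\sup_{l\in\mathcal L(\omega)}\ \inf_{m\in\mathcal M(\omega)}c(z[\omega,l,m])\quad(\omega\in\Omega),\qquad \mathcal V_T=\mathbb V[v_T],\quad \mathcal W_\lambda=\mathbb V[w_\lambda].$$ Assume that both payoff families satisfy the Dynamic Programming Principle, that is: (a) for all $T>0$ and all $h\in(0,T)$, $\mathcal V_T=\mathbb V[c]$ for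 the payoff $c(z)=\frac1T\int_0^h g(z(t))\,dt+\frac{T-h}{T}\,\mathcal V_{T-h}(z(h))$; (b) for all $\lambda>0$ and all $h>0$, $\mathcal W_\lambda=\mathbb V[c]$ for the payoff $c(z)=\lambda\int_0^h e^{-\lambda t}g(z(t))\,dt+e^{-\lambda h}\,\mathcal W_\lambda(z(h))$. Then the following two statements are equivalent: (i) the functions $\mathcal V_T$ $(T>0)$ converge uniformly on $\Omega$ as $T\uparrow\infty$; (ii) the functions $\mathcal W_\lambda$ $(\lambda>0)$ converge uniformly on $\Omega$ as $\lambda\downarrow0$. Moreover, when at least one of these statements holds, $\lim_{T\uparrow\infty}\mathcal V_T(\omega)=\lim_{\lambda\downarrow0}\mathcal W_\lambda(\omega)$ for all $\omega\in\Omega$. -/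

import Mathlib

open Filter Topology MeasureTheory
open scoped NNReal

universe u v w

noncomputable section

/-- The data of a dynamic zero-sum game in continuous time on the state space `Ω`. No structure
on `Ω` or on the sets of rules, and no further relation between the data, is required. -/
structure DynamicGame (Ω : Type u) where
  /-- the set of processes, which are maps from `[0, ∞)` to `Ω` -/
  processes : Set (ℝ≥0 → Ω)
  processes_nonempty : processes.Nonempty
  /-- the running cost -/
  cost : Ω → ℝ
  cost_mem : ∀ ω, cost ω ∈ Set.Icc (0 : ℝ) 1
  cost_measurable : ∀ z ∈ processes, Measurable fun t : ℝ≥0 => cost (z t)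
  /-- the rules available to the first player at a given initial state -/
  L : Ω → Type v
  /-- the rules available to the second player at a given initial state -/
  M : Ω → Type w
  L_nonempty : ∀ ω, Nonempty (L ω)
  M_nonempty : ∀ ω, Nonempty (M ω)
  /-- the process generated by an initial state and a pair of rules -/
  play : (ω : Ω) → L ω → M ω → processes
  play_zero : ∀ (ω : Ω) (l : L ω) (m : M ω), (play ω l m : ℝ≥0 → Ω) 0 = ω

namespace DynamicGame

variable {Ω : Type u} (G : DynamicGame.{u, v, w} Ω)

/-- The running cost along a process, as a function of a real time `t`; only `t ≥ 0` matters. -/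
def costAlong (z : G.processes) (t : ℝ) : ℝ := G.cost ((z : ℝ≥0 → Ω) t.toNNReal)

/-- The time average `v_T(z) = (1/T) ∫₀ᵀ g(z(t)) dt`. -/
def cesaro (T : ℝ) (z : G.processes) : ℝ :=
  1 / T * ∫ t in (0 : ℝ)..T, G.costAlong z t

/-- The discounted average `w_r(z) = r ∫₀^∞ e^{-r t} g(z(t)) dt`. -/
def abel (r : ℝ) (z : G.processes) : ℝ :=
  r * ∫ t in Set.Ioi (0 : ℝ), Real.exp (-(r * t)) * G.costAlong z t

/-- The lower value `sup_l inf_m c(z[ω, l, m])` of the game with payoff `c`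
(meant for bounded `c`). -/
def value (c : G.processes → ℝ) (ω : Ω) : ℝ :=
  ⨆ l : G.L ω, ⨅ m : G.M ω, c (G.play ω l m)

/-- The value function of the game with horizon `T`. -/
def cesaroValue (T : ℝ) : Ω → ℝ := G.value (G.cesaro T)

/-- The value function of the game with discount rate `r`. -/
def abelValue (r : ℝ) : Ω → ℝ := G.value (G.abel r)

/-- The Dynamic Programming Principle for the family of time averages. -/
def CesaroDPP : Prop :=
  ∀ T : ℝ, 0 < T → ∀ h : ℝ≥0, 0 < h → (h : ℝ) < T →
    G.cesaroValue T = G.value fun z =>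
      1 / T * (∫ t in (0 : ℝ)..h, G.costAlong z t) +
        (T - h) / T * G.cesaroValue (T - h) ((z : ℝ≥0 → Ω) h)

/-- The Dynamic Programming Principle for the family of discounted averages. -/
def AbelDPP : Prop :=
  ∀ r : ℝ, 0 < r → ∀ h : ℝ≥0, 0 < h →
    G.abelValue r = G.value fun z =>
      r * (∫ t in (0 : ℝ)..h, Real.exp (-(r * t)) * G.costAlong z t) +
        Real.exp (-(r * h)) * G.abelValue r ((z : ℝ≥0 → Ω) h)

end DynamicGame

end

namespace DynamicGame

variable {Ω : Type u} (G : DynamicGame.{u, v, w} Ω)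

/-! Take the rate `T⁻¹` and apply both Dynamic Programming Principles over the time `s * T`. The two
right-hand sides then nearly agree: the payoffs collected on `[0, s * T]` differ by at most `s ^ 2`,
and so do the weights `1 - s` and `exp (-s)` of the continuation. Since `value` is nonexpansive,
`abs_cesaroValue_sub_abelValue_le` bounds the distance at `T` by a contracted distance between
horizon `(1 - s) * T` and rate `T⁻¹`. Uniform convergence of either family makes that shift of
horizon cost at most `s ^ 2` for large `T`. Iterating leaves an error of order `s ^ 2` per step over
a contraction gap `s / 2`, hence of order `s`, and `s` is arbitrary. -/

lemma costAlong_nonneg (z : G.processes) (t : ℝ) : 0 ≤ G.costAlong z t := (G.cost_mem _).1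

lemma costAlong_le_one (z : G.processes) (t : ℝ) : G.costAlong z t ≤ 1 := (G.cost_mem _).2

lemma measurable_costAlong (z : G.processes) : Measurable (G.costAlong z) :=
  (G.cost_measurable z z.2).comp measurable_real_toNNReal

lemma intervalIntegrable_costAlong (z : G.processes) (a b : ℝ) :
    IntervalIntegrable (G.costAlong z) volume a b := by
  refine (intervalIntegrable_const (c := (1 : ℝ))).mono_fun
    (G.measurable_costAlong z).aestronglyMeasurable (Eventually.of_forall fun t => ?_)
  simp only [Real.norm_of_nonneg (G.costAlong_nonneg z t), norm_one]
  exact G.costAlong_le_one z t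

lemma intervalIntegrable_exp_mul_costAlong (z : G.processes) (r a b : ℝ) :
    IntervalIntegrable (fun t => Real.exp (-(r * t)) * G.costAlong z t) volume a b :=
  (G.intervalIntegrable_costAlong z a b).continuousOn_mul (by fun_prop)

lemma cesaro_mem {T : ℝ} (hT : 0 < T) (z : G.processes) : G.cesaro T z ∈ Set.Icc (0 : ℝ) 1 := by
  have h0 : 0 ≤ ∫ t in (0 : ℝ)..T, G.costAlong z t :=
    intervalIntegral.integral_nonneg hT.le fun t _ => G.costAlong_nonneg z t
  have h1 : (∫ t in (0 : ℝ)..T, G.costAlong z t) ≤ ∫ _ in (0 : ℝ)..T, (1 : ℝ) :=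
    intervalIntegral.integral_mono_on hT.le (G.intervalIntegrable_costAlong z 0 T)
      intervalIntegrable_const fun t _ => G.costAlong_le_one z t
  rw [intervalIntegral.integral_const, smul_eq_mul, mul_one, sub_zero] at h1
  refine ⟨by unfold cesaro; positivity, ?_⟩
  unfold cesaro
  rw [one_div, inv_mul_le_iff₀ hT, mul_one]
  exact h1

lemma abel_mem {r : ℝ} (hr : 0 < r) (z : G.processes) : G.abel r z ∈ Set.Icc (0 : ℝ) 1 := by
  have hexp : IntegrableOn (fun t => Real.exp (-r * t)) (Set.Ioi (0 : ℝ)) :=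
    integrableOn_exp_mul_Ioi (neg_lt_zero.mpr hr) 0
  have h1 : (∫ t in Set.Ioi (0 : ℝ), Real.exp (-(r * t)) * G.costAlong z t) ≤
      ∫ t in Set.Ioi (0 : ℝ), Real.exp (-r * t) := by
    refine integral_mono_of_nonneg (Eventually.of_forall fun t => ?_) hexp
      (Eventually.of_forall fun t => ?_)
    · exact mul_nonneg (Real.exp_pos _).le (G.costAlong_nonneg z t)
    · simp only [neg_mul]
      exact mul_le_of_le_one_right (Real.exp_pos _).le (G.costAlong_le_one z t)
  rw [integral_exp_mul_Ioi (neg_lt_zero.mpr hr), mul_zero, Real.exp_zero, neg_div_neg_eq] at h1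
  refine ⟨mul_nonneg hr.le (integral_nonneg fun t =>
    mul_nonneg (Real.exp_pos _).le (G.costAlong_nonneg z t)), ?_⟩
  calc G.abel r z ≤ r * (1 / r) := mul_le_mul_of_nonneg_left h1 hr.le
    _ = 1 := mul_one_div_cancel hr.ne'

/-! ### The value operator -/

/-- Real `⨅` and `⨆` default to `0` on unbounded ranges, so bounds on the payoff are carried
throughout. -/
lemma bddBelow_range_play {c : G.processes → ℝ} {B : ℝ} (hc : ∀ z, |c z| ≤ B) (ω : Ω) (l : G.L ω) :
    BddBelow (Set.range fun m : G.M ω => c (G.play ω l m)) :=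
  ⟨-B, by rintro _ ⟨m, rfl⟩; exact (abs_le.mp (hc _)).1⟩

lemma bddAbove_range_iInf_play {c : G.processes → ℝ} {B : ℝ} (hc : ∀ z, |c z| ≤ B) (ω : Ω) :
    BddAbove (Set.range fun l : G.L ω => ⨅ m : G.M ω, c (G.play ω l m)) := by
  obtain ⟨m⟩ := G.M_nonempty ω
  refine ⟨B, ?_⟩
  rintro _ ⟨l, rfl⟩
  exact (ciInf_le (G.bddBelow_range_play hc ω l) m).trans (abs_le.mp (hc _)).2

/-- `value` is monotone and commutes with adding constants; this yields nonexpansiveness in the sup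
norm. -/
lemma value_le_value_add {c d : G.processes → ℝ} {B δ : ℝ} (hc : ∀ z, |c z| ≤ B)
    (hd : ∀ z, |d z| ≤ B) (h : ∀ z, c z ≤ d z + δ) (ω : Ω) :
    G.value c ω ≤ G.value d ω + δ := by
  have := G.L_nonempty ω
  have := G.M_nonempty ω
  refine ciSup_le fun l => ?_
  rw [← sub_le_iff_le_add]
  refine le_trans (le_ciInf fun m => ?_) (le_ciSup (G.bddAbove_range_iInf_play hd ω) l)
  have := ciInf_le (G.bddBelow_range_play hc ω l) m
  linarith [h (G.play ω l m)]

lemma abs_value_sub_value_le {c d : G.processes → ℝ} {B δ : ℝ} (hc : ∀ z, |c z| ≤ B)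
    (hd : ∀ z, |d z| ≤ B) (h : ∀ z, |c z - d z| ≤ δ) (ω : Ω) :
    |G.value c ω - G.value d ω| ≤ δ := by
  rw [abs_sub_le_iff]
  constructor
  · linarith [G.value_le_value_add hc hd (fun z => by linarith [(abs_le.mp (h z)).2]) ω]
  · linarith [G.value_le_value_add hd hc (fun z => by linarith [(abs_le.mp (h z)).1]) ω]

lemma value_mem {c : G.processes → ℝ} (hc : ∀ z, c z ∈ Set.Icc (0 : ℝ) 1) (ω : Ω) :
    G.value c ω ∈ Set.Icc (0 : ℝ) 1 := by
  have hB : ∀ z, |c z| ≤ 1 := fun z => abs_le.mpr ⟨by linarith [(hc z).1], (hc z).2⟩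
  have := G.L_nonempty ω
  have := G.M_nonempty ω
  obtain ⟨l⟩ := G.L_nonempty ω
  obtain ⟨m⟩ := G.M_nonempty ω
  exact ⟨(le_ciInf fun m => (hc _).1).trans (le_ciSup (G.bddAbove_range_iInf_play hB ω) l),
    ciSup_le fun l => (ciInf_le (G.bddBelow_range_play hB ω l) m).trans (hc _).2⟩

lemma cesaroValue_mem {T : ℝ} (hT : 0 < T) (ω : Ω) : G.cesaroValue T ω ∈ Set.Icc (0 : ℝ) 1 :=
  G.value_mem (G.cesaro_mem hT) ω

lemma abelValue_mem {r : ℝ} (hr : 0 < r) (ω : Ω) : G.abelValue r ω ∈ Set.Icc (0 : ℝ) 1 :=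
  G.value_mem (G.abel_mem hr) ω

/-! ### Comparison over one time step -/

/-- On `[0, h]` the integrands differ by at most `1 - exp (-(r * t)) ≤ r * h`. -/
lemma abs_integral_sub_integral_exp_le (z : G.processes) {r h : ℝ} (hr : 0 < r) (hh : 0 ≤ h) :
    |r * (∫ t in (0 : ℝ)..h, G.costAlong z t) -
      r * ∫ t in (0 : ℝ)..h, Real.exp (-(r * t)) * G.costAlong z t| ≤ (r * h) ^ 2 := by
  rw [← mul_sub, ← intervalIntegral.integral_sub (G.intervalIntegrable_costAlong z 0 h)
    (G.intervalIntegrable_exp_mul_costAlong z r 0 h), abs_mul, abs_of_pos hr]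
  have hle : ‖∫ t in (0 : ℝ)..h, (G.costAlong z t - Real.exp (-(r * t)) * G.costAlong z t)‖ ≤
      (r * h) * |h - 0| := by
    refine intervalIntegral.norm_integral_le_of_norm_le_const fun t ht => ?_
    rw [Set.uIoc_of_le hh] at ht
    have h1 : 1 - Real.exp (-(r * t)) ≤ r * h := by
      have := Real.add_one_le_exp (-(r * t))
      have := mul_le_mul_of_nonneg_left ht.2 hr.le
      linarith
    have h0 : 0 ≤ 1 - Real.exp (-(r * t)) := by
      have : Real.exp (-(r * t)) ≤ 1 := Real.exp_le_one_iff.mpr (by nlinarith [ht.1])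
      linarith
    have hg := G.costAlong_nonneg z t
    have e : G.costAlong z t - Real.exp (-(r * t)) * G.costAlong z t =
      (1 - Real.exp (-(r * t))) * G.costAlong z t := by ring
    rw [e, Real.norm_of_nonneg (mul_nonneg h0 hg)]
    exact (mul_le_of_le_one_right h0 (G.costAlong_le_one z t)).trans h1
  rw [sub_zero, abs_of_nonneg hh, Real.norm_eq_abs] at hle
  calc _ ≤ r * (r * h * h) := mul_le_mul_of_nonneg_left hle hr.le
    _ = (r * h) ^ 2 := by ring

lemma exp_neg_le_one_sub_add_sq {t : ℝ} (h0 : 0 ≤ t) (h1 : t ≤ 1) :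
    Real.exp (-t) ≤ 1 - t + t ^ 2 := by
  have := Real.abs_exp_sub_one_sub_id_le (x := -t) (by rwa [abs_neg, abs_of_nonneg h0])
  linarith [(abs_le.mp this).2, neg_sq t]

/-- Comparing the two Dynamic Programming Principles over the time `s * T` contracts the distance
between the two value functions, up to an error of second order in `s`. -/
lemma abs_cesaroValue_sub_abelValue_le (hv : G.CesaroDPP) (hw : G.AbelDPP) {T s D : ℝ}
    (hT : 0 < T) (hs : 0 < s) (hs' : s ≤ 1 / 2)
    (hD : ∀ ω, |G.cesaroValue ((1 - s) * T) ω - G.abelValue T⁻¹ ω| ≤ D) (ω : Ω) :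
    |G.cesaroValue T ω - G.abelValue T⁻¹ ω| ≤ 2 * s ^ 2 + (1 - s / 2) * D := by
  have hD0 : 0 ≤ D := (abs_nonneg _).trans (hD ω)
  have hr : 0 < T⁻¹ := inv_pos.mpr hT
  have hh : 0 < s * T := mul_pos hs hT
  have hT' : 0 < (1 - s) * T := mul_pos (by linarith) hT
  have hrh : T⁻¹ * (s * T) = s := by field_simp
  obtain ⟨h, hdef⟩ : ∃ h : ℝ≥0, (h : ℝ) = s * T := ⟨⟨s * T, hh.le⟩, rfl⟩
  have hpos : 0 < h := by rw [← NNReal.coe_pos, hdef]; exact hh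
  have he1 := exp_neg_le_one_sub_add_sq hs.le (by linarith)
  have he0 := Real.add_one_le_exp (-s)
  have hint0 (z : G.processes) : 0 ≤ ∫ t in (0 : ℝ)..(s * T), G.costAlong z t :=
    intervalIntegral.integral_nonneg hh.le fun t _ => G.costAlong_nonneg z t
  have hint1 (z : G.processes) : T⁻¹ * (∫ t in (0 : ℝ)..(s * T), G.costAlong z t) ≤ s := by
    have := (G.cesaro_mem hh z).2
    rw [cesaro, one_div, inv_mul_le_iff₀ hh, mul_one] at this
    calc _ ≤ T⁻¹ * (s * T) := mul_le_mul_of_nonneg_left this hr.le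
      _ = s := hrh
  have hdiff (z : G.processes) := G.abs_integral_sub_integral_exp_le z hr hh.le
  simp only [hrh] at hdiff
  have e1 : T - s * T = (1 - s) * T := by ring
  have e2 : (1 - s) * T / T = 1 - s := by field_simp
  rw [hv T hT h hpos (by rw [hdef]; nlinarith), hw T⁻¹ hr h hpos]
  simp only [hdef, e1, e2, hrh, one_div]
  -- The bound `4` is crude and does not enter the estimate.
  refine G.abs_value_sub_value_le (B := 4) (fun z => ?_) (fun z => ?_) (fun z => ?_) ω
  all_goals
    set y := (z : ℝ≥0 → Ω) h
    obtain ⟨hV0, hV1⟩ := G.cesaroValue_mem hT' y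
    obtain ⟨hW0, hW1⟩ := G.abelValue_mem hr y
    obtain ⟨hd1, hd2⟩ := abs_le.mp (hdiff z)
    have hI0 := mul_nonneg hr.le (hint0 z)
    have hI1 := hint1 z
    have hE := Real.exp_pos (-s)
    set I := T⁻¹ * ∫ t in (0 : ℝ)..(s * T), G.costAlong z t
    set J := T⁻¹ * ∫ t in (0 : ℝ)..(s * T), Real.exp (-(T⁻¹ * t)) * G.costAlong z t
    set E := Real.exp (-s)
    set V := G.cesaroValue ((1 - s) * T) y
    set W := G.abelValue T⁻¹ y
  · rw [abs_le]; constructor <;> nlinarith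
  · have := mul_nonneg hE.le hW0
    have : E * W ≤ E := mul_le_of_le_one_right hE.le hW1
    rw [abs_le]; constructor <;> nlinarith
  -- The three errors come from the collected payoff, the weight, and the continuation value.
  · have e : I + (1 - s) * V - (J + E * W) = (I - J) + ((1 - s) - E) * V + E * (V - W) := by ring
    have h1 : |((1 - s) - E) * V| ≤ s ^ 2 := by
      rw [abs_mul, abs_of_nonneg hV0]
      refine (mul_le_of_le_one_right (abs_nonneg _) hV1).trans (abs_le.mpr ⟨?_, ?_⟩) <;> nlinarith
    have h2 : |E * (V - W)| ≤ (1 - s / 2) * D := by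
      rw [abs_mul, abs_of_pos hE]
      -- Here `exp (-s) ≤ 1 - s + s ^ 2 ≤ 1 - s / 2`, because `s ≤ 1 / 2`.
      exact mul_le_mul (by nlinarith) (hD y) (abs_nonneg _) (by linarith)
    rw [e]
    calc _ ≤ |I - J| + |((1 - s) - E) * V| + |E * (V - W)| := abs_add_three _ _ _
      _ ≤ s ^ 2 + s ^ 2 + (1 - s / 2) * D := add_le_add (add_le_add (hdiff z) h1) h2
      _ = _ := by ring

/-- If the two value functions for the horizons `T` and `(1 - s) * T` are close for one of the two
families, then the two families are close to each other. -/
lemma eventually_abs_cesaroValue_sub_abelValue_le (hv : G.CesaroDPP) (hw : G.AbelDPP) {s T₀ : ℝ}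
    (hs : 0 < s) (hs' : s ≤ 1 / 2) (hT₀ : 0 < T₀)
    (h : (∀ T, T₀ ≤ T → ∀ ω, |G.cesaroValue ((1 - s) * T) ω - G.cesaroValue T ω| ≤ s ^ 2) ∨
      ∀ T, T₀ ≤ T → ∀ ω, |G.abelValue ((1 - s) * T)⁻¹ ω - G.abelValue T⁻¹ ω| ≤ s ^ 2) (n : ℕ) :
    ∀ᶠ T in atTop, ∀ ω, |G.cesaroValue T ω - G.abelValue T⁻¹ ω| ≤ 6 * s + (1 - s / 2) ^ n := by
  induction n with
  | zero =>
    filter_upwards [eventually_gt_atTop 0] with T hT ω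
    obtain ⟨hV0, hV1⟩ := G.cesaroValue_mem hT ω
    obtain ⟨hW0, hW1⟩ := G.abelValue_mem (inv_pos.mpr hT) ω
    rw [pow_zero, abs_le]
    constructor <;> linarith
  | succ n ih =>
    have hlim : Tendsto (fun T : ℝ => (1 - s) * T) atTop atTop :=
      tendsto_id.const_mul_atTop (by linarith)
    -- The Cesàro alternative uses the induction hypothesis at `T`, the Abel one at `(1 - s) * T`.
    -- The threshold for `T` may grow with `n`, which is harmless as `n` is fixed in the end.
    filter_upwards [ih, hlim.eventually ih, eventually_ge_atTop T₀] with T h1 h2 h3 ω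
    have hD : ∀ ω, |G.cesaroValue ((1 - s) * T) ω - G.abelValue T⁻¹ ω| ≤
        6 * s + (1 - s / 2) ^ n + s ^ 2 := by
      intro ω
      rcases h with h | h
      · have := abs_sub_le (G.cesaroValue ((1 - s) * T) ω) (G.cesaroValue T ω) (G.abelValue T⁻¹ ω)
        linarith [h T h3 ω, h1 ω]
      · have := abs_sub_le (G.cesaroValue ((1 - s) * T) ω) (G.abelValue ((1 - s) * T)⁻¹ ω)
          (G.abelValue T⁻¹ ω)
        linarith [h T h3 ω, h2 ω]
    refine (G.abs_cesaroValue_sub_abelValue_le hv hw (hT₀.trans_le h3) hs hs' hD ω).trans ?_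
    have : 0 < s ^ 3 := by positivity
    -- The constant `6` comes from the total error `3 * s ^ 2` divided by the gap `s / 2`.
    have e : 2 * s ^ 2 + (1 - s / 2) * (6 * s + (1 - s / 2) ^ n + s ^ 2) =
        6 * s + (1 - s / 2) ^ (n + 1) - s ^ 3 / 2 := by ring
    linarith

/-! ### Transfer of uniform convergence -/

lemma _root_.TendstoUniformly.exists_abs_sub_le_of_mul {F : ℝ → Ω → ℝ} {U : Ω → ℝ}
    (hF : TendstoUniformly F U atTop) {a ε : ℝ} (ha : 0 < a) (hε : 0 < ε) :
    ∃ T₀ : ℝ, 0 < T₀ ∧ ∀ T, T₀ ≤ T → ∀ ω, |F (a * T) ω - F T ω| ≤ ε := by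
  have h1 := Metric.tendstoUniformly_iff.mp hF (ε / 2) (half_pos hε)
  have h2 := (tendsto_id.const_mul_atTop ha : Tendsto (fun T : ℝ => a * T) atTop atTop).eventually h1
  obtain ⟨T₀, hT₀⟩ := eventually_atTop.mp (h1.and h2)
  refine ⟨max T₀ 1, by positivity, fun T hT ω => ?_⟩
  obtain ⟨h3, h4⟩ := hT₀ T ((le_max_left _ _).trans hT)
  rw [← Real.dist_eq]
  linarith [dist_triangle_left (F (a * T) ω) (F T ω) (U ω), h3 ω, h4 ω]

lemma eventually_abs_cesaroValue_sub_abelValue_lt (hv : G.CesaroDPP) (hw : G.AbelDPP)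
    (h : (∃ U : Ω → ℝ, TendstoUniformly G.cesaroValue U atTop) ∨
      ∃ U : Ω → ℝ, TendstoUniformly (fun T => G.abelValue T⁻¹) U atTop) {ε : ℝ} (hε : 0 < ε) :
    ∀ᶠ T in atTop, ∀ ω, |G.cesaroValue T ω - G.abelValue T⁻¹ ω| < ε := by
  obtain ⟨s, hs, hs', hsε⟩ : ∃ s : ℝ, 0 < s ∧ s ≤ 1 / 2 ∧ 6 * s ≤ ε / 2 :=
    ⟨min (1 / 2) (ε / 12), by positivity, min_le_left _ _,
      by linarith [min_le_right (1 / 2 : ℝ) (ε / 12)]⟩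
  obtain ⟨T₀, hT₀, h⟩ : ∃ T₀ : ℝ, 0 < T₀ ∧
      ((∀ T, T₀ ≤ T → ∀ ω, |G.cesaroValue ((1 - s) * T) ω - G.cesaroValue T ω| ≤ s ^ 2) ∨
        ∀ T, T₀ ≤ T → ∀ ω, |G.abelValue ((1 - s) * T)⁻¹ ω - G.abelValue T⁻¹ ω| ≤ s ^ 2) := by
    have ha : 0 < 1 - s := by linarith
    have hs2 : 0 < s ^ 2 := by positivity
    rcases h with ⟨U, hU⟩ | ⟨U, hU⟩
    · obtain ⟨T₀, h0, h⟩ := hU.exists_abs_sub_le_of_mul ha hs2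
      exact ⟨T₀, h0, Or.inl h⟩
    · obtain ⟨T₀, h0, h⟩ := hU.exists_abs_sub_le_of_mul ha hs2
      exact ⟨T₀, h0, Or.inr h⟩
  obtain ⟨n, hn⟩ := exists_pow_lt_of_lt_one (half_pos hε) (show 1 - s / 2 < 1 by linarith)
  filter_upwards [G.eventually_abs_cesaroValue_sub_abelValue_le hv hw hs hs' hT₀ h n] with T hT ω
  linarith [hT ω]

lemma _root_.TendstoUniformly.of_abs_sub_lt {ι : Type*} {l : Filter ι} {F F' : ι → Ω → ℝ}
    {U : Ω → ℝ} (hF : TendstoUniformly F U l)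
    (h : ∀ ε > 0, ∀ᶠ i in l, ∀ ω, |F i ω - F' i ω| < ε) : TendstoUniformly F' U l := by
  rw [Metric.tendstoUniformly_iff] at hF ⊢
  intro ε hε
  filter_upwards [hF (ε / 2) (half_pos hε), h (ε / 2) (half_pos hε)] with i h1 h2 ω
  have := h2 ω
  rw [← Real.dist_eq] at this
  linarith [dist_triangle (U ω) (F i ω) (F' i ω), h1 ω]

lemma tendstoUniformly_abelValue_iff (U : Ω → ℝ) :
    TendstoUniformly G.abelValue U (𝓝[>] 0) ↔
      TendstoUniformly (fun T => G.abelValue T⁻¹) U atTop := by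
  constructor
  · intro h u hu
    exact tendsto_inv_atTop_nhdsGT_zero.eventually (h u hu)
  · intro h u hu
    simpa only [inv_inv] using tendsto_inv_nhdsGT_zero.eventually (h u hu)

lemma tendstoUniformly_cesaroValue_iff_abelValue (hv : G.CesaroDPP) (hw : G.AbelDPP) (U : Ω → ℝ) :
    TendstoUniformly G.cesaroValue U atTop ↔ TendstoUniformly G.abelValue U (𝓝[>] 0) := by
  rw [tendstoUniformly_abelValue_iff]
  constructor
  · intro h
    exact h.of_abs_sub_lt fun ε hε =>
      G.eventually_abs_cesaroValue_sub_abelValue_lt hv hw (Or.inl ⟨U, h⟩) hε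
  · intro h
    refine h.of_abs_sub_lt fun ε hε => ?_
    simpa only [abs_sub_comm] using
      G.eventually_abs_cesaroValue_sub_abelValue_lt hv hw (Or.inr ⟨U, h⟩) hε

end DynamicGame

theorem theorem1 {Ω : Type u} [Nonempty Ω] (G : DynamicGame.{u, v, w} Ω)
    (hv : G.CesaroDPP) (hw : G.AbelDPP) :
    ((∃ U : Ω → ℝ, TendstoUniformly G.cesaroValue U atTop) ↔
      (∃ U : Ω → ℝ, TendstoUniformly G.abelValue U (𝓝[>] 0))) ∧
    (((∃ U : Ω → ℝ, TendstoUniformly G.cesaroValue U atTop) ∨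
      (∃ U : Ω → ℝ, TendstoUniformly G.abelValue U (𝓝[>] 0))) →
      ∀ ω : Ω, ∃ x : ℝ, Tendsto (fun T : ℝ => G.cesaroValue T ω) atTop (𝓝 x) ∧
        Tendsto (fun r : ℝ => G.abelValue r ω) (𝓝[>] 0) (𝓝 x)) := by
  have key := G.tendstoUniformly_cesaroValue_iff_abelValue hv hw
  refine ⟨exists_congr key, ?_⟩
  rintro (⟨U, h⟩ | ⟨U, h⟩) ω
  · exact ⟨U ω, h.tendsto_at ω, ((key U).mp h).tendsto_at ω⟩
  · exact ⟨U ω, ((key U).mpr h).tendsto_at ω, h.tendsto_at ω⟩
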